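/- Let $k\ge 0$ and let $d_1,\dots,d_k\ge 1$ be integers, $D=\prod_{i=1}^k d_i$, and $0\le r\le D$. Let $\Pi$ be a Haar-random orthogonal projector of rank $r$ on $\bigotimes_{i=1}^k\mathbb{C}^{d_i}\cong\mathbb{C}^D$, that is, $\Pi=U\Pi_0U^\dagger$, where $\Pi_0$ is any fixed orthogonal projector of rank $r$ and $U$ is distributed according to the Haar probability measure on the unitary group $U(D)$. Let $$\nu(\Pi)=\max\Bigl\{\operatorname{tr}\bigl((|\varphi_1\rangle\langle\varphi_1|\otimes\cdots\otimes|\varphi_k\rangle\langle\varphi_k|)\,\Pi\bigr) : |\varphi_i\rangle\in\mathbb{C}^{d_i},\ \|\varphi_i\|=1 \text{ for } i=1,\dots,k\Bigr\}$$ be its maximum overlap with a product state. Then for every $\gamma>0$, $$\Pr_\Pi\bigl[\nu(\Pi)\ge\gamma\bigr]\ \le\ \inf_{n\ge 0}\ \frac{\binom{r+n-1}{n}\prod_{i=1}^k\binom{d_i+n-1}{n}}{\gamma^n\binom{D+n-1}{n}},$$ where the infimum is over all integers $n\ge 0$, and every binomial coefficient $\binom{a+n-1}{n}$ is read as $1$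 for $n=0$ (and as $0$ for $a=0$, $n\ge 1$). -/

import Mathlib

open MeasureTheory
open scoped Matrix ComplexConjugate

noncomputable section

namespace RandomProjector

/-- The index set of the product basis of `⊗ᵢ ℂ^{dᵢ}`; it has `∏ᵢ dᵢ` elements, and the basis vector
with index `x` is `e_{x 0} ⊗ ⋯ ⊗ e_{x (k-1)}`. -/
abbrev Idx {k : ℕ} (d : Fin k → ℕ) : Type := (i : Fin k) → Fin (d i)

/-- Operators on `⊗ᵢ ℂ^{dᵢ}`, as matrices in the (orthonormal) product basis. -/
abbrev Op {k : ℕ} (d : Fin k → ℕ) : Type := Matrix (Idx d) (Idx d) ℂ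

/-- The tensor (Kronecker) product `A₁ ⊗ ⋯ ⊗ A_k` of operators `Aᵢ` on `ℂ^{dᵢ}`. -/
def tensor {k : ℕ} {d : Fin k → ℕ} (A : (i : Fin k) → Matrix (Fin (d i)) (Fin (d i)) ℂ) : Op d :=
  Matrix.of fun x y => ∏ i, A i (x i) (y i)

/-- The rank-one operator `|φ⟩⟨φ|` on `ℂ^m`. -/
def ketbra {m : ℕ} (φ : EuclideanSpace ℂ (Fin m)) : Matrix (Fin m) (Fin m) ℂ :=
  Matrix.of fun a b => φ a * conj (φ b)

/-- The values `tr ((φ₁ ⊗ ⋯ ⊗ φ_k) M)` over all families of unit vectors `|φᵢ⟩ ∈ ℂ^{dᵢ}`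
(the trace is real when `M` is Hermitian). -/
def overlaps {k : ℕ} (d : Fin k → ℕ) (M : Op d) : Set ℝ :=
  {t | ∃ φ : (i : Fin k) → EuclideanSpace ℂ (Fin (d i)), (∀ i, ‖φ i‖ = 1) ∧
    t = (Matrix.trace (tensor (fun i => ketbra (φ i)) * M)).re}

/-- `ν(M)`, the maximum overlap of `M` with a product state. -/
def nu {k : ℕ} (d : Fin k → ℕ) (M : Op d) : ℝ := sSup (overlaps d M)

/-- The supremum in `nu` is a maximum. -/
theorem isGreatest_nu {k : ℕ} (d : Fin k → ℕ) (hd : ∀ i, 0 < d i) (M : Op d) :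
    IsGreatest (overlaps d M) (nu d M) := by
  have himg : overlaps d M =
      (fun φ : (i : Fin k) → EuclideanSpace ℂ (Fin (d i)) =>
        (Matrix.trace (tensor (fun i => ketbra (φ i)) * M)).re) ''
      (Set.univ.pi fun i => Metric.sphere (0 : EuclideanSpace ℂ (Fin (d i))) 1) := by
    ext t
    simp only [overlaps, Set.mem_ofPred_eq, Set.mem_image, Set.mem_univ_pi, mem_sphere_zero_iff_norm]
    exact exists_congr fun φ => and_congr_right fun _ => eq_comm
  have hc : IsCompact (overlaps d M) := by
    rw [himg]
    refine (isCompact_univ_pi fun i => isCompact_sphere _ _).image ?_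
    unfold tensor ketbra
    simp only [Matrix.trace, Matrix.diag, Matrix.mul_apply, Matrix.of_apply]
    fun_prop
  have hne : (overlaps d M).Nonempty := by
    refine ⟨_, fun i => EuclideanSpace.single (⟨0, hd i⟩ : Fin (d i)) (1 : ℂ), fun i => ?_, rfl⟩
    simp
  exact hc.isGreatest_sSup hne

/-- The unitary group is compact. -/
instance instCompactSpaceUnitary (ι : Type) [Fintype ι] [DecidableEq ι] :
    CompactSpace (Matrix.unitaryGroup ι ℂ) := by
  have hcl : IsClosed ((Matrix.unitaryGroup ι ℂ : Set (Matrix ι ι ℂ))) := isClosed_unitary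
  have hsub : (Matrix.unitaryGroup ι ℂ : Set (Matrix ι ι ℂ)) ⊆
      Set.univ.pi fun _ : ι => Set.univ.pi fun _ : ι => Metric.closedBall (0 : ℂ) 1 := by
    intro U hU i _ j _
    simpa using entry_norm_bound_of_unitary hU i j
  exact isCompact_iff_compactSpace.mp ((isCompact_univ_pi fun _ => isCompact_univ_pi fun _ =>
    isCompact_closedBall (0 : ℂ) 1).of_isClosed_subset hcl hsub)

/-- The Borel `σ`-algebra on matrices (the unitary group carries the induced one, which is again
its Borel `σ`-algebra). -/
instance instMeasurableSpaceMatrix (ι : Type) [Fintype ι] : MeasurableSpace (Matrix ι ι ℂ) :=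
  borel _

instance instBorelSpaceMatrix (ι : Type) [Fintype ι] : BorelSpace (Matrix ι ι ℂ) := ⟨rfl⟩

/-- The Haar probability measure on the unitary group `U(ι)`. -/
def haarUnitary (ι : Type) [Fintype ι] [DecidableEq ι] : Measure (Matrix.unitaryGroup ι ℂ) :=
  Measure.haarMeasure ⊤

instance instIsProbabilityMeasureHaarUnitary (ι : Type) [Fintype ι] [DecidableEq ι] :
    IsProbabilityMeasure (haarUnitary ι) :=
  ⟨by simpa [haarUnitary] using
    Measure.haarMeasure_self (K₀ := (⊤ : TopologicalSpace.PositiveCompacts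
      (Matrix.unitaryGroup ι ℂ)))⟩

/-- The law of `U P U†`, for `U` a Haar-random unitary. When `P` is an orthogonal projector of rank
`r`, this is the law of a Haar-random (uniformly random) orthogonal projector of rank `r`. -/
def haarConj {k : ℕ} {d : Fin k → ℕ} (P : Op d) : Measure (Op d) :=
  (haarUnitary (Idx d)).map fun U : Matrix.unitaryGroup (Idx d) ℂ => (U : Op d) * P * (U : Op d)ᴴ

theorem continuous_conj {k : ℕ} {d : Fin k → ℕ} (P : Op d) :
    Continuous fun U : Matrix.unitaryGroup (Idx d) ℂ => (U : Op d) * P * (U : Op d)ᴴ := by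
  fun_prop

instance instIsProbabilityMeasureHaarConj {k : ℕ} {d : Fin k → ℕ} (P : Op d) :
    IsProbabilityMeasure (haarConj P) :=
  Measure.isProbabilityMeasure_map (continuous_conj P).measurable.aemeasurable

end RandomProjector

end

namespace RandomProjector

/-! Markov's inequality for the `n`-th moment of `ν(Π)`, where the maximum over product states is
replaced by an average over Haar-random product states `ψ`, at the cost of a factor `∏ᵢ
C(dᵢ+n-1,n)`. After swapping the two averages, `ψ` is fixed and only `E_Π[tr(ψ Π)ⁿ] =
C(r+n-1,n)/C(D+n-1,n)` is needed.

That moment (`lintegral_haar_partial_norm_sq_pow`) comes from integrating against a Gaussian weight,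
which is unitarily invariant.

Maximum versus average (`norm_sq_pow_le_lintegral_haar`): for one factor, with `a = ‖Bφ‖²`,
Cauchy–Schwarz gives `a‖By‖² ≥ |⟨B†Bφ, y⟩|²`. The `n`-th moment of the right side over random unit
`y` is `‖B†Bφ‖²ⁿ / C(m+n-1,n) ≥ a²ⁿ / C(m+n-1,n)`; divide by `aⁿ`. Multilinearity allows this one
tensor factor at a time (`norm_sq_pow_le_lmarginal_haar`). -/

theorem card_piAntidiag {ι : Type*} [DecidableEq ι] (S : Finset ι) (n : ℕ) :
    (S.piAntidiag n).card = (S.card + n - 1).choose n := by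
  rw [← Finset.card_finsuppAntidiag_nat_eq_choose, Finset.finsuppAntidiag, Finset.card_map,
    Finset.card_attach]

/-! ### Gaussian moments on `ℂ^ι`. -/

theorem integral_norm_sq_pow_mul_exp (a : ℕ) :
    ∫ z : ℂ, (‖z‖ ^ 2) ^ a * Real.exp (-‖z‖ ^ 2) = Real.pi * a.factorial := by
  have h := Complex.integral_rpow_mul_exp_neg_rpow (p := 2) (q := 2 * a) (by norm_num)
    (by have : (0 : ℝ) ≤ a := a.cast_nonneg
        linarith)
  rw [show (2 * (a : ℝ) + 2) / 2 = a + 1 by ring, Real.Gamma_nat_eq_factorial] at h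
  rw [show Real.pi * a.factorial = 2 * Real.pi / 2 * a.factorial by ring, ← h]
  refine integral_congr_ae (.of_forall fun z => ?_)
  simp only [← pow_mul]
  congr 1
  · exact_mod_cast (Real.rpow_natCast ‖z‖ (2 * a)).symm
  · exact_mod_cast rfl

theorem integrable_norm_sq_pow_mul_exp (a : ℕ) :
    Integrable fun z : ℂ => (‖z‖ ^ 2) ^ a * Real.exp (-‖z‖ ^ 2) := by
  -- A non-integrable function has integral `0` by convention, so a nonzero integral proves
  -- integrability.
  refine not_imp_comm.1 integral_undef ?_
  rw [integral_norm_sq_pow_mul_exp]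
  positivity

section Gaussian

variable {ι : Type} [Fintype ι]

theorem exp_neg_sum_norm_sq_mul_prod (a : ι → ℕ) (x : ι → ℂ) :
    (∏ i, (‖x i‖ ^ 2) ^ a i) * Real.exp (-∑ i, ‖x i‖ ^ 2) =
      ∏ i, ((‖x i‖ ^ 2) ^ a i * Real.exp (-‖x i‖ ^ 2)) := by
  rw [Finset.prod_mul_distrib, ← Real.exp_sum, Finset.sum_neg_distrib]

theorem integrable_prod_norm_sq_pow_mul_exp (a : ι → ℕ) :
    Integrable fun x : ι → ℂ =>
      (∏ i, (‖x i‖ ^ 2) ^ a i) * Real.exp (-∑ i, ‖x i‖ ^ 2) := by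
  simp_rw [exp_neg_sum_norm_sq_mul_prod]
  exact Integrable.fintype_prod (f := fun i (z : ℂ) => (‖z‖ ^ 2) ^ a i * Real.exp (-‖z‖ ^ 2))
    fun i => integrable_norm_sq_pow_mul_exp (a i)

theorem integral_prod_norm_sq_pow_mul_exp (a : ι → ℕ) :
    ∫ x : ι → ℂ, (∏ i, (‖x i‖ ^ 2) ^ a i) * Real.exp (-∑ i, ‖x i‖ ^ 2) =
      Real.pi ^ Fintype.card ι * ∏ i, ((a i).factorial : ℝ) := by
  simp_rw [exp_neg_sum_norm_sq_mul_prod]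
  rw [integral_fintype_prod_volume_eq_prod
    (fun i (z : ℂ) => (‖z‖ ^ 2) ^ a i * Real.exp (-‖z‖ ^ 2))]
  simp [integral_norm_sq_pow_mul_exp, Finset.prod_mul_distrib]

variable [DecidableEq ι]

theorem partial_norm_sq_pow_mul_exp_eq_sum (S : Finset ι) (n : ℕ) (x : ι → ℂ) :
    (∑ i ∈ S, ‖x i‖ ^ 2) ^ n * Real.exp (-∑ i, ‖x i‖ ^ 2) =
      ∑ a ∈ S.piAntidiag n, (Nat.multinomial S a : ℝ) *
        ((∏ i, (‖x i‖ ^ 2) ^ a i) * Real.exp (-∑ i, ‖x i‖ ^ 2)) := by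
  rw [Finset.sum_pow_eq_sum_piAntidiag, Finset.sum_mul]
  refine Finset.sum_congr rfl fun a ha => ?_
  rw [mul_assoc, Finset.prod_subset (Finset.subset_univ S)]
  intro i _ hi
  have : a i = 0 := by
    by_contra h
    exact hi ((Finset.mem_piAntidiag.1 ha).2 i h)
  simp [this]

theorem integrable_partial_norm_sq_pow_mul_exp (S : Finset ι) (n : ℕ) :
    Integrable fun x : ι → ℂ => (∑ i ∈ S, ‖x i‖ ^ 2) ^ n * Real.exp (-∑ i, ‖x i‖ ^ 2) := by
  simp_rw [partial_norm_sq_pow_mul_exp_eq_sum]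
  exact integrable_finsetSum _ fun a _ => (integrable_prod_norm_sq_pow_mul_exp a).const_mul _

/-- In the multinomial expansion the coefficient `n!/∏ aᵢ!` cancels the Gaussian moment `∏ aᵢ!`, so
all monomials contribute equally and the binomial counts them. Truncated subtraction gives the right
count for empty `S`: `1` if `n = 0`, else `0`. -/
theorem integral_partial_norm_sq_pow_mul_exp (S : Finset ι) (n : ℕ) :
    ∫ x : ι → ℂ, (∑ i ∈ S, ‖x i‖ ^ 2) ^ n * Real.exp (-∑ i, ‖x i‖ ^ 2) =
      Real.pi ^ Fintype.card ι * n.factorial * (S.card + n - 1).choose n := by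
  simp_rw [partial_norm_sq_pow_mul_exp_eq_sum]
  rw [integral_finsetSum _ fun a _ => (integrable_prod_norm_sq_pow_mul_exp a).const_mul _]
  simp_rw [integral_const_mul, integral_prod_norm_sq_pow_mul_exp]
  rw [Finset.sum_congr rfl (g := fun _ => Real.pi ^ Fintype.card ι * n.factorial),
    Finset.sum_const, card_piAntidiag, nsmul_eq_mul, mul_comm]
  intro a ha
  obtain ⟨hsum, hsupp⟩ := Finset.mem_piAntidiag.1 ha
  have hprod : ∏ i, ((a i).factorial : ℝ) = ∏ i ∈ S, ((a i).factorial : ℝ) := by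
    refine (Finset.prod_subset (Finset.subset_univ S) fun i _ hi => ?_).symm
    have : a i = 0 := by
      by_contra h
      exact hi (hsupp i h)
    simp [this]
  have hspec := Nat.multinomial_spec S a
  rw [hsum] at hspec
  rw [hprod, ← hspec]
  push_cast
  ring

theorem lintegral_partial_norm_sq_pow_mul_exp (S : Finset ι) (n : ℕ) :
    ∫⁻ x : ι → ℂ, ENNReal.ofReal ((∑ i ∈ S, ‖x i‖ ^ 2) ^ n) *
        ENNReal.ofReal (Real.exp (-∑ i, ‖x i‖ ^ 2)) =
      ENNReal.ofReal (Real.pi ^ Fintype.card ι * n.factorial) * ((S.card + n - 1).choose n : ℕ) := by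
  rw [← ENNReal.ofReal_natCast, ← ENNReal.ofReal_mul (by positivity),
    ← integral_partial_norm_sq_pow_mul_exp, ofReal_integral_eq_lintegral_ofReal
      (integrable_partial_norm_sq_pow_mul_exp S n) (.of_forall fun x => by positivity)]
  refine lintegral_congr fun x => ?_
  rw [ENNReal.ofReal_mul (by positivity)]

end Gaussian

theorem star_dotProduct_self {ι : Type} [Fintype ι] (x : ι → ℂ) : star x ⬝ᵥ x = ((∑ i, ‖x i‖ ^ 2 : ℝ) : ℂ) := by
  simp [dotProduct, Complex.conj_mul']

/-! ### Unitaries acting on vectors and on Lebesgue measure. -/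

section Unitary

variable {ι : Type} [Fintype ι] [DecidableEq ι]

theorem sum_norm_sq_unitary_mulVec (U : Matrix.unitaryGroup ι ℂ) (x : ι → ℂ) :
    ∑ i, ‖((U : Matrix ι ι ℂ) *ᵥ x) i‖ ^ 2 = ∑ i, ‖x i‖ ^ 2 := by
  have h := star_dotProduct_self ((U : Matrix ι ι ℂ) *ᵥ x)
  rw [Matrix.star_mulVec, ← Matrix.dotProduct_mulVec, Matrix.mulVec_mulVec,
    ← Matrix.star_eq_conjTranspose, Matrix.UnitaryGroup.star_mul_self, Matrix.one_mulVec,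
    star_dotProduct_self] at h
  exact_mod_cast h.symm

theorem measurePreserving_unitary_mulVec (U : Matrix.unitaryGroup ι ℂ) :
    MeasurePreserving (fun x : ι → ℂ => (U : Matrix ι ι ℂ) *ᵥ x) := by
  -- The determinant over `ℝ` is the squared modulus of the complex one.
  have hdet : |LinearMap.det ((Matrix.toLin' (U : Matrix ι ι ℂ)).restrictScalars ℝ)| = 1 := by
    rw [LinearMap.det_restrictScalars, LinearMap.det_toLin', Algebra.norm_complex_eq]
    have h := Unitary.mem_iff.1 (Matrix.det_of_mem_unitary U.2)
    have h2 := h.1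
    rw [Complex.star_def, ← Complex.normSq_eq_conj_mul_self] at h2
    have h3 : Complex.normSq (Matrix.det (U : Matrix ι ι ℂ)) = 1 := by exact_mod_cast h2
    simp [h3]
  refine ⟨by fun_prop, ?_⟩
  have h0 : LinearMap.det ((Matrix.toLin' (U : Matrix ι ι ℂ)).restrictScalars ℝ) ≠ 0 := by
    intro h
    simp [h] at hdet
  have := Measure.map_linearMap_addHaar_eq_smul_addHaar (volume : Measure (ι → ℂ)) h0
  rw [abs_inv, hdet, inv_one, ENNReal.ofReal_one, one_smul] at this
  exact this

theorem exists_unitary_mulVec_single (i₀ : ι) (x : ι → ℂ) :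
    ∃ (W : Matrix.unitaryGroup ι ℂ) (t : ℝ), 0 ≤ t ∧
      x = (t : ℂ) • ((W : Matrix ι ι ℂ) *ᵥ Pi.single i₀ 1) := by
  by_cases hx : x = 0
  · exact ⟨1, 0, le_rfl, by simp [hx]⟩
  let y : EuclideanSpace ℂ ι := WithLp.toLp 2 x
  have hy : ‖y‖ ≠ 0 := by
    rw [norm_ne_zero_iff]
    intro h
    exact hx (by simpa [y] using h)
  -- Only the value at `i₀` matters: the normalised `x` is extended to an orthonormal basis, whose
  -- coordinate matrix is the unitary.
  let v : ι → EuclideanSpace ℂ ι := fun _ => ((‖y‖⁻¹ : ℝ) : ℂ) • y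
  have hv : Orthonormal ℂ (({i₀} : Set ι).domRestrict v) := by
    rw [orthonormal_iff_ite]
    rintro ⟨i, rfl⟩ ⟨j, rfl⟩
    have : ‖v j‖ = 1 := by simp [v, norm_smul, hy]
    simp [Set.domRestrict, inner_self_eq_norm_sq_to_K, this]
  obtain ⟨b, hb⟩ := hv.exists_orthonormalBasis_extension_of_card_eq (by simp)
  refine ⟨⟨(EuclideanSpace.basisFun ι ℂ).toBasis.toMatrix b,
    (EuclideanSpace.basisFun ι ℂ).toMatrix_orthonormalBasis_mem_unitary b⟩, ‖y‖, norm_nonneg y, ?_⟩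
  ext i
  have h1 := hb i₀ rfl
  simp only [Matrix.mulVec_single_one, Pi.smul_apply, Matrix.col_apply, Module.Basis.toMatrix_apply,
    h1, v, smul_eq_mul]
  change x i = (‖y‖ : ℂ) * (((‖y‖⁻¹ : ℝ) : ℂ) * x i)
  rw [Complex.ofReal_inv, ← mul_assoc, mul_inv_cancel₀ (by exact_mod_cast hy), one_mul]

theorem sum_norm_sq_smul_unitary_mulVec_single (i₀ : ι) (W : Matrix.unitaryGroup ι ℂ) (t : ℝ) :
    ∑ i, ‖((t : ℂ) • ((W : Matrix ι ι ℂ) *ᵥ Pi.single i₀ (1 : ℂ))) i‖ ^ 2 = t ^ 2 := by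
  simp only [Pi.smul_apply, norm_smul, mul_pow, ← Finset.mul_sum]
  rw [sum_norm_sq_unitary_mulVec, Finset.sum_eq_single i₀] <;> simp +contextual

theorem exists_unitary_inv_mulVec_single_eq (i₀ : ι) {x : ι → ℂ} (hx : ∑ i, ‖x i‖ ^ 2 = 1) :
    ∃ W : Matrix.unitaryGroup ι ℂ, (W⁻¹).1 *ᵥ Pi.single i₀ 1 = x := by
  obtain ⟨W, t, ht, rfl⟩ := exists_unitary_mulVec_single i₀ x
  rw [sum_norm_sq_smul_unitary_mulVec_single, pow_eq_one_iff_of_nonneg ht two_ne_zero] at hx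
  exact ⟨W⁻¹, by simp [hx]⟩

end Unitary

/-! ### Moments of Haar-random vectors. -/

section Haar

variable {ι : Type} [Fintype ι] [DecidableEq ι]

instance instSecondCountableTopologyMatrix (ι : Type) [Fintype ι] :
    SecondCountableTopology (Matrix ι ι ℂ) :=
  inferInstanceAs (SecondCountableTopology (ι → ι → ℂ))

instance instSecondCountableTopologyUnitary (ι : Type) [Fintype ι] [DecidableEq ι] :
    SecondCountableTopology (Matrix.unitaryGroup ι ℂ) :=
  TopologicalSpace.Subtype.secondCountableTopology (Matrix.unitaryGroup ι ℂ : Set (Matrix ι ι ℂ))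

instance instIsMulLeftInvariantHaarUnitary (ι : Type) [Fintype ι] [DecidableEq ι] :
    (haarUnitary ι).IsMulLeftInvariant := by
  unfold haarUnitary
  infer_instance

theorem continuous_partial_norm_sq_mulVec_pow (V : Matrix.unitaryGroup ι ℂ) (S : Finset ι)
    (n : ℕ) : Continuous fun x : ι → ℂ =>
      ENNReal.ofReal ((∑ i ∈ S, ‖((V : Matrix ι ι ℂ) *ᵥ x) i‖ ^ 2) ^ n) :=
  ENNReal.continuous_ofReal.comp (by fun_prop)

theorem continuous_inv_mulVec : Continuous fun p : Matrix.unitaryGroup ι ℂ × (ι → ℂ) =>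
    ((p.1⁻¹ : Matrix.unitaryGroup ι ℂ) : Matrix ι ι ℂ) *ᵥ p.2 := by
  fun_prop

/-- Acting by `U⁻¹` turns left invariance of Haar measure into invariance in the vector: `(W⁻¹U)⁻¹ =
U⁻¹W`. -/
theorem lintegral_haar_inv_mulVec_unitary (f : (ι → ℂ) → ENNReal) (W : Matrix.unitaryGroup ι ℂ)
    (x : ι → ℂ) :
    ∫⁻ U, f (((U⁻¹ : Matrix.unitaryGroup ι ℂ) : Matrix ι ι ℂ) *ᵥ ((W : Matrix ι ι ℂ) *ᵥ x))
        ∂haarUnitary ι =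
      ∫⁻ U, f (((U⁻¹ : Matrix.unitaryGroup ι ℂ) : Matrix ι ι ℂ) *ᵥ x) ∂haarUnitary ι := by
  rw [← lintegral_mul_left_eq_self
    (fun U => f (((U⁻¹ : Matrix.unitaryGroup ι ℂ) : Matrix ι ι ℂ) *ᵥ x)) W⁻¹]
  refine lintegral_congr fun U => ?_
  rw [mul_inv_rev, inv_inv, Matrix.mulVec_mulVec, Submonoid.coe_mul]

/-- The average is homogeneous in `x` and unitarily invariant, and unitaries act transitively on
spheres, so it depends on `x` only through its norm. -/
theorem lintegral_haar_partial_norm_sq_eq_mul (i₀ : ι) (V : Matrix.unitaryGroup ι ℂ)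
    (S : Finset ι) (n : ℕ) (x : ι → ℂ) :
    ∫⁻ U, ENNReal.ofReal ((∑ i ∈ S, ‖((V : Matrix ι ι ℂ) *ᵥ
        (((U⁻¹ : Matrix.unitaryGroup ι ℂ) : Matrix ι ι ℂ) *ᵥ x)) i‖ ^ 2) ^ n) ∂haarUnitary ι =
      ENNReal.ofReal ((∑ i, ‖x i‖ ^ 2) ^ n) *
      ∫⁻ U, ENNReal.ofReal ((∑ i ∈ S, ‖((V : Matrix ι ι ℂ) *ᵥ
        (((U⁻¹ : Matrix.unitaryGroup ι ℂ) : Matrix ι ι ℂ) *ᵥ Pi.single i₀ 1)) i‖ ^ 2) ^ n)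
        ∂haarUnitary ι := by
  obtain ⟨W, t, -, rfl⟩ := exists_unitary_mulVec_single i₀ x
  rw [sum_norm_sq_smul_unitary_mulVec_single, ← lintegral_haar_inv_mulVec_unitary
    (fun y => ENNReal.ofReal ((∑ i ∈ S, ‖((V : Matrix ι ι ℂ) *ᵥ y) i‖ ^ 2) ^ n)) W
      (Pi.single i₀ 1),
    ← lintegral_const_mul']
  · refine lintegral_congr fun U => ?_
    rw [← ENNReal.ofReal_mul (by positivity), ← mul_pow, Finset.mul_sum]
    simp [Matrix.mulVec_smul, mul_pow]
  · exact ENNReal.ofReal_ne_top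

/-- The moments of the squared norm of a coordinate projection of a Haar-random vector. -/
theorem lintegral_haar_partial_norm_sq_pow [Nonempty ι] (V : Matrix.unitaryGroup ι ℂ)
    (S : Finset ι) (n : ℕ) (x : ι → ℂ) :
    (∫⁻ U, ENNReal.ofReal ((∑ i ∈ S, ‖((V : Matrix ι ι ℂ) *ᵥ
        (((U⁻¹ : Matrix.unitaryGroup ι ℂ) : Matrix ι ι ℂ) *ᵥ x)) i‖ ^ 2) ^ n) ∂haarUnitary ι) *
      ((Fintype.card ι + n - 1).choose n : ℕ) =
      ENNReal.ofReal ((∑ i, ‖x i‖ ^ 2) ^ n) * ((S.card + n - 1).choose n : ℕ) := by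
  obtain ⟨i₀⟩ := ‹Nonempty ι›
  rw [lintegral_haar_partial_norm_sq_eq_mul i₀, mul_assoc]
  congr 1
  set c := ∫⁻ U, ENNReal.ofReal ((∑ i ∈ S, ‖((V : Matrix ι ι ℂ) *ᵥ
    (((U⁻¹ : Matrix.unitaryGroup ι ℂ) : Matrix ι ι ℂ) *ᵥ Pi.single i₀ 1)) i‖ ^ 2) ^ n)
    ∂haarUnitary ι with hc
  let w : (ι → ℂ) → ENNReal := fun x => ENNReal.ofReal (Real.exp (-∑ i, ‖x i‖ ^ 2))
  have hw : Continuous w := ENNReal.continuous_ofReal.comp (by fun_prop)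
  let K : ENNReal := ENNReal.ofReal (Real.pi ^ Fintype.card ι * n.factorial)
  have hK0 : K ≠ 0 := by
    simp only [K, ne_eq, ENNReal.ofReal_eq_zero, not_le]
    positivity
  have hKtop : K ≠ ⊤ := ENNReal.ofReal_ne_top
  let g : Matrix.unitaryGroup ι ℂ → (ι → ℂ) → ENNReal := fun U x =>
    ENNReal.ofReal ((∑ i ∈ S, ‖((V : Matrix ι ι ℂ) *ᵥ
      (((U⁻¹ : Matrix.unitaryGroup ι ℂ) : Matrix ι ι ℂ) *ᵥ x)) i‖ ^ 2) ^ n)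
  have hg : Continuous (Function.uncurry g) :=
    (continuous_partial_norm_sq_mulVec_pow V S n).comp continuous_inv_mulVec
  have hgw : Measurable (Function.uncurry fun U x => g U x * w x) :=
    hg.measurable.mul (hw.measurable.comp measurable_snd)
  -- The same double integral in both orders: Haar first leaves `c` times the full Gaussian moment,
  -- Gaussian first leaves the moment of the `S`-coordinates, whatever `U` is.
  have h1 : ∫⁻ x : ι → ℂ, ∫⁻ U, g U x * w x ∂haarUnitary ι =
      c * (K * ((Fintype.card ι + n - 1).choose n : ℕ)) := by
    have h := lintegral_partial_norm_sq_pow_mul_exp (Finset.univ : Finset ι) n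
    rw [Finset.card_univ] at h
    rw [← h, ← lintegral_const_mul]
    · refine lintegral_congr fun x => ?_
      rw [lintegral_mul_const' _ _ ENNReal.ofReal_ne_top,
        lintegral_haar_partial_norm_sq_eq_mul i₀, ← hc]
      ring
    · fun_prop
  have h2 : ∀ U : Matrix.unitaryGroup ι ℂ, ∫⁻ x : ι → ℂ, g U x * w x =
      K * ((S.card + n - 1).choose n : ℕ) := by
    intro U
    rw [← lintegral_partial_norm_sq_pow_mul_exp,
      ← (measurePreserving_unitary_mulVec (V * U⁻¹)).lintegral_comp
        (f := fun x => ENNReal.ofReal ((∑ i ∈ S, ‖x i‖ ^ 2) ^ n) *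
          ENNReal.ofReal (Real.exp (-∑ i, ‖x i‖ ^ 2))) (by fun_prop)]
    refine lintegral_congr fun x => ?_
    rw [sum_norm_sq_unitary_mulVec]
    simp only [g, w, Submonoid.coe_mul, Matrix.mulVec_mulVec]
  have h3 := lintegral_lintegral_swap (μ := haarUnitary ι) (ν := (volume : Measure (ι → ℂ)))
    hgw.aemeasurable
  simp_rw [h2] at h3
  rw [h1, lintegral_const, measure_univ, mul_one, mul_left_comm] at h3
  exact ((ENNReal.mul_right_inj hK0 hKtop).1 h3).symm

end Haar

/-! ### Projectors in coordinates, and maximum versus average for one factor. -/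

theorem norm_star_dotProduct_sq_le {ι : Type} [Fintype ι] (w x : ι → ℂ) :
    ‖star w ⬝ᵥ x‖ ^ 2 ≤ (∑ i, ‖w i‖ ^ 2) * ∑ i, ‖x i‖ ^ 2 := by
  have h := norm_inner_le_norm (𝕜 := ℂ) (WithLp.toLp 2 w) (WithLp.toLp 2 x)
  rw [EuclideanSpace.inner_toLp_toLp, dotProduct_comm] at h
  have h2 := pow_le_pow_left₀ (norm_nonneg _) h 2
  rwa [mul_pow, EuclideanSpace.norm_sq_eq, EuclideanSpace.norm_sq_eq] at h2

section Projector

variable {ι : Type} [Fintype ι] [DecidableEq ι]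

theorem exists_unitary_star_dotProduct_mulVec {P : Matrix ι ι ℂ} (hP : IsStarProjection P) :
    ∃ (V : Matrix.unitaryGroup ι ℂ) (S : Finset ι), S.card = P.rank ∧
      ∀ x, star x ⬝ᵥ (P *ᵥ x) = ((∑ i ∈ S, ‖((V : Matrix ι ι ℂ) *ᵥ x) i‖ ^ 2 : ℝ) : ℂ) := by
  have hA : P.IsHermitian := hP.isSelfAdjoint
  have hval : ∀ i, hA.eigenvalues i = 0 ∨ hA.eigenvalues i = 1 := by
    intro i
    have h1 := hA.mulVec_eigenvectorBasis i
    have h2 : P *ᵥ (P *ᵥ ⇑(hA.eigenvectorBasis i)) = P *ᵥ ⇑(hA.eigenvectorBasis i) := by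
      rw [Matrix.mulVec_mulVec, hP.isIdempotentElem.eq]
    rw [h1, Matrix.mulVec_smul, h1, smul_smul, ← sub_eq_zero, ← sub_smul] at h2
    have hne : (⇑(hA.eigenvectorBasis i) : ι → ℂ) ≠ 0 := by
      intro h
      exact hA.eigenvectorBasis.orthonormal.ne_zero i (by ext j; exact congrFun h j)
    have h3 := (smul_eq_zero.1 h2).resolve_right hne
    rcases mul_eq_zero.1 (show hA.eigenvalues i * (hA.eigenvalues i - 1) = 0 by
      linear_combination h3) with h | h
    · exact .inl h
    · exact .inr (by linarith)
  refine ⟨star hA.eigenvectorUnitary, Finset.univ.filter fun i => hA.eigenvalues i ≠ 0, ?_,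
    fun x => ?_⟩
  · rw [hA.rank_eq_card_non_zero_eigs, Fintype.card_subtype]
  · set W := hA.eigenvectorUnitary
    have hs : P = (W : Matrix ι ι ℂ) *
        Matrix.diagonal (RCLike.ofReal ∘ hA.eigenvalues) * star (W : Matrix ι ι ℂ) := by
      conv_lhs => rw [hA.spectral_theorem]
      rfl
    set y := star (W : Matrix ι ι ℂ) *ᵥ x with hy
    have h1 : star x ⬝ᵥ (P *ᵥ x) =
        star y ⬝ᵥ (Matrix.diagonal (RCLike.ofReal ∘ hA.eigenvalues) *ᵥ y) := by
      conv_lhs => rw [hs]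
      rw [hy, Matrix.star_mulVec, ← Matrix.dotProduct_mulVec, Matrix.mulVec_mulVec,
        Matrix.mulVec_mulVec, ← Matrix.star_eq_conjTranspose, star_star, mul_assoc]
    rw [h1, Finset.sum_filter]
    push_cast
    refine Finset.sum_congr rfl fun i _ => ?_
    rw [Matrix.mulVec_diagonal]
    rcases hval i with h | h
    · simp [h]
    · simp [h, hy, Complex.conj_mul']

/-- After rotating `w` to a multiple of a basis vector this is the moment formula for a single
coordinate, where `C(1+n-1,n) = 1`. -/
theorem lintegral_haar_star_dotProduct_pow [Nonempty ι] (w x : ι → ℂ) (n : ℕ) :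
    (∫⁻ U, ENNReal.ofReal ((‖star w ⬝ᵥ
        (((U⁻¹ : Matrix.unitaryGroup ι ℂ) : Matrix ι ι ℂ) *ᵥ x)‖ ^ 2) ^ n) ∂haarUnitary ι) *
      ((Fintype.card ι + n - 1).choose n : ℕ) =
      ENNReal.ofReal ((∑ i, ‖w i‖ ^ 2) ^ n) * ENNReal.ofReal ((∑ i, ‖x i‖ ^ 2) ^ n) := by
  obtain ⟨i₀⟩ := ‹Nonempty ι›
  obtain ⟨W, t, -, rfl⟩ := exists_unitary_mulVec_single i₀ w
  have h := lintegral_haar_partial_norm_sq_pow W⁻¹ {i₀} n x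
  rw [Finset.card_singleton, Nat.add_sub_cancel_left, Nat.choose_self, Nat.cast_one, mul_one] at h
  rw [sum_norm_sq_smul_unitary_mulVec_single, ← h, ← mul_assoc, ← lintegral_const_mul' _ _ ENNReal.ofReal_ne_top]
  congr 1
  refine lintegral_congr fun U => ?_
  rw [← ENNReal.ofReal_mul (by positivity), ← mul_pow, Finset.sum_singleton, star_smul,
    Matrix.star_mulVec, smul_dotProduct, ← Matrix.dotProduct_mulVec, norm_smul, mul_pow]
  simp only [← Pi.single_star, star_one, single_dotProduct, one_mul]
  simp [Matrix.star_eq_conjTranspose]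

/-- The value at a unit vector of the `n`-th power of a positive semidefinite form is at most
`C(m+n-1,n)` times its average over the sphere. -/
theorem norm_sq_pow_le_lintegral_haar [Nonempty ι] {E : Type*} [NormedAddCommGroup E]
    [InnerProductSpace ℂ E] (B : (ι → ℂ) →ₗ[ℂ] E) (n : ℕ) {φ x : ι → ℂ}
    (hφ : ∑ i, ‖φ i‖ ^ 2 = 1) (hx : ∑ i, ‖x i‖ ^ 2 = 1) :
    ENNReal.ofReal ((‖B φ‖ ^ 2) ^ n) ≤ ((Fintype.card ι + n - 1).choose n : ℕ) *
      ∫⁻ U, ENNReal.ofReal ((‖B (((U⁻¹ : Matrix.unitaryGroup ι ℂ) : Matrix ι ι ℂ) *ᵥ x)‖ ^ 2) ^ n)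
        ∂haarUnitary ι := by
  set a := ‖B φ‖ ^ 2 with ha
  -- The split is on `aⁿ`, the factor cancelled below, which is `1` when `n = 0` even if `a = 0`.
  by_cases h0 : ENNReal.ofReal (a ^ n) = 0
  · simp [h0]
  -- This is `B†Bφ` in coordinates.
  let w : ι → ℂ := fun i => inner ℂ (B (Pi.single i 1)) (B φ)
  have hw : ∀ y, star w ⬝ᵥ y = inner ℂ (B φ) (B y) := by
    intro y
    conv_rhs => rw [pi_eq_sum_univ' y]
    rw [map_sum, inner_sum]
    refine Finset.sum_congr rfl fun i _ => ?_
    rw [map_smul, inner_smul_right, mul_comm]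
    simp [w]
  have haw : a * a ≤ ∑ i, ‖w i‖ ^ 2 := by
    have h := norm_star_dotProduct_sq_le w φ
    rw [hw, hφ, mul_one, inner_self_eq_norm_sq_to_K] at h
    refine le_trans (le_of_eq ?_) h
    simp [ha, pow_two]
  have hmom := lintegral_haar_star_dotProduct_pow w x n
  rw [hx, one_pow, ENNReal.ofReal_one, mul_one] at hmom
  refine (ENNReal.mul_le_mul_iff_right h0 ENNReal.ofReal_ne_top).1 ?_
  calc ENNReal.ofReal (a ^ n) * ENNReal.ofReal (a ^ n)
      = ENNReal.ofReal ((a * a) ^ n) := by rw [← ENNReal.ofReal_mul (by positivity), mul_pow]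
    _ ≤ ENNReal.ofReal ((∑ i, ‖w i‖ ^ 2) ^ n) := by gcongr
    _ = _ := hmom.symm
    _ ≤ (∫⁻ U, ENNReal.ofReal (a ^ n) * ENNReal.ofReal
          ((‖B (((U⁻¹ : Matrix.unitaryGroup ι ℂ) : Matrix ι ι ℂ) *ᵥ x)‖ ^ 2) ^ n) ∂haarUnitary ι) *
        ((Fintype.card ι + n - 1).choose n : ℕ) := by
        gcongr with U
        rw [← ENNReal.ofReal_mul (by positivity), ← mul_pow, hw, ← mul_pow]
        gcongr
        exact norm_inner_le_norm _ _
    _ = _ := by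
        rw [lintegral_const_mul' _ _ ENNReal.ofReal_ne_top, mul_assoc, mul_comm (∫⁻ _, _ ∂_)]

end Projector

/-! ### Product vectors, one tensor factor at a time. -/

section Multilinear

variable {k : ℕ} {d : Fin k → ℕ}

/-- The family of vectors `Uᵢ⁻¹ xᵢ`. -/
def rotate (x : (i : Fin k) → Fin (d i) → ℂ)
    (U : (i : Fin k) → Matrix.unitaryGroup (Fin (d i)) ℂ) (i : Fin k) : Fin (d i) → ℂ :=
  ((U i)⁻¹ : Matrix.unitaryGroup (Fin (d i)) ℂ).1 *ᵥ x i

theorem rotate_update (x : (i : Fin k) → Fin (d i) → ℂ)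
    (U : (i : Fin k) → Matrix.unitaryGroup (Fin (d i)) ℂ) (i : Fin k)
    (v : Matrix.unitaryGroup (Fin (d i)) ℂ) :
    rotate x (Function.update U i v) = Function.update (rotate x U) i (v⁻¹.1 *ᵥ x i) := by
  funext j
  obtain rfl | h := eq_or_ne j i
  · simp [rotate]
  · simp [rotate, h]

theorem continuous_rotate (x : (i : Fin k) → Fin (d i) → ℂ) : Continuous (rotate x) := by
  unfold rotate
  fun_prop

/-- Induction on the set of averaged factors: with all other arguments frozen, `T` is linear in the
`i`-th, so the one-factor bound applies under the integral over `s`. -/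
theorem norm_sq_pow_le_lmarginal_haar (hd : ∀ i, 0 < d i) {E : Type*} [NormedAddCommGroup E]
    [InnerProductSpace ℂ E] (T : MultilinearMap ℂ (fun i => Fin (d i) → ℂ) E)
    (hT : Continuous T) (n : ℕ) {x : (i : Fin k) → Fin (d i) → ℂ}
    (hx : ∀ i, ∑ j, ‖x i j‖ ^ 2 = 1) (s : Finset (Fin k))
    (U : (i : Fin k) → Matrix.unitaryGroup (Fin (d i)) ℂ) :
    ENNReal.ofReal ((‖T (rotate x U)‖ ^ 2) ^ n) ≤
      (∏ i ∈ s, ((d i + n - 1).choose n : ENNReal)) *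
        (∫⋯∫⁻_s, (fun U => ENNReal.ofReal ((‖T (rotate x U)‖ ^ 2) ^ n))
          ∂fun i => haarUnitary (Fin (d i))) U := by
  set F := fun U => ENNReal.ofReal ((‖T (rotate x U)‖ ^ 2) ^ n) with hF
  have hFm : Measurable F := (ENNReal.continuous_ofReal.comp
    (((hT.comp (continuous_rotate x)).norm.pow 2).pow n)).measurable
  change F U ≤ _
  induction s using Finset.induction_on with
  | empty => simp
  | insert i s hi ih =>
    have : Nonempty (Fin (d i)) := ⟨⟨0, hd i⟩⟩
    rw [lmarginal_insert' F hFm hi, Finset.prod_insert hi, mul_comm ((d i + n - 1).choose n : ENNReal),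
      mul_assoc]
    refine ih.trans (mul_le_mul_right ?_ _)
    rw [lmarginal, lmarginal, ← lintegral_const_mul' _ _ (ENNReal.natCast_ne_top _)]
    refine lintegral_mono fun y => ?_
    set z := Function.updateFinset U s y
    have h := norm_sq_pow_le_lintegral_haar (T.toLinearMap (rotate x z) i) n
      (φ := rotate x z i) ((sum_norm_sq_unitary_mulVec _ _).trans (hx i)) (hx i)
    rw [Fintype.card_fin] at h
    simpa only [hF, rotate_update, MultilinearMap.toLinearMap_apply, Function.update_eq_self] using h

/-- The multilinear map `φ ↦ A (φ₁ ⊗ ⋯ ⊗ φ_k)`. -/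
noncomputable def mulVecTensor (A : Op d) :
    MultilinearMap ℂ (fun i => Fin (d i) → ℂ) (EuclideanSpace ℂ (Idx d)) :=
  ((WithLp.linearEquiv 2 ℂ (Idx d → ℂ)).symm.toLinearMap ∘ₗ Matrix.mulVecLin A).compMultilinearMap
    (MultilinearMap.pi fun y => (MultilinearMap.mkPiAlgebra ℂ (Fin k) ℂ).compLinearMap
      fun i => LinearMap.proj (y i))

theorem mulVecTensor_apply (A : Op d) (φ : (i : Fin k) → Fin (d i) → ℂ) :
    mulVecTensor A φ = WithLp.toLp 2 (A *ᵥ fun y => ∏ i, φ i (y i)) := by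
  simp [mulVecTensor]
  rfl

theorem sum_norm_sq_prod (φ : (i : Fin k) → Fin (d i) → ℂ) :
    ∑ y : Idx d, ‖∏ i, φ i (y i)‖ ^ 2 = ∏ i, ∑ j, ‖φ i j‖ ^ 2 := by
  rw [Finset.prod_univ_sum]
  simp [Finset.prod_pow, Fintype.piFinset_univ]

theorem trace_tensor_ketbra_mul (φ : (i : Fin k) → EuclideanSpace ℂ (Fin (d i))) (M : Op d) :
    Matrix.trace (tensor (fun i => ketbra (φ i)) * M) =
      star (fun y : Idx d => ∏ i, φ i (y i)) ⬝ᵥ (M *ᵥ fun y => ∏ i, φ i (y i)) := by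
  simp only [Matrix.trace, Matrix.diag, Matrix.mul_apply, tensor, ketbra, Matrix.of_apply,
    dotProduct, Matrix.mulVec, Finset.mul_sum, Pi.star_apply, star_prod, Finset.prod_mul_distrib]
  rw [Finset.sum_comm]
  refine Finset.sum_congr rfl fun y _ => Finset.sum_congr rfl fun z _ => ?_
  simp only [Complex.star_def]
  ring

theorem star_dotProduct_conj_mulVec (P : Op d)
    (U : Matrix.unitaryGroup (Idx d) ℂ) (y : Idx d → ℂ) :
    star y ⬝ᵥ (((U : Op d) * P * (U : Op d)ᴴ) *ᵥ y) =
      star ((U⁻¹ : Matrix.unitaryGroup (Idx d) ℂ).1 *ᵥ y) ⬝ᵥ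
        (P *ᵥ ((U⁻¹ : Matrix.unitaryGroup (Idx d) ℂ).1 *ᵥ y)) := by
  rw [Matrix.star_mulVec, ← Matrix.dotProduct_mulVec, Matrix.mulVec_mulVec, Matrix.mulVec_mulVec]
  simp [Matrix.star_eq_conjTranspose, mul_assoc]

theorem star_dotProduct_projection_mulVec {P : Op d} (hP : IsStarProjection P) (y : Idx d → ℂ) :
    star y ⬝ᵥ (P *ᵥ y) = ((‖WithLp.toLp 2 (P *ᵥ y)‖ ^ 2 : ℝ) : ℂ) := by
  rw [EuclideanSpace.norm_sq_eq, ← star_dotProduct_self, Matrix.star_mulVec,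
    ← Matrix.dotProduct_mulVec, Matrix.mulVec_mulVec, ← Matrix.star_eq_conjTranspose,
    hP.isSelfAdjoint.star_eq, hP.isIdempotentElem.eq]

theorem re_trace_tensor_ketbra_mul_conj {P : Op d} (hP : IsStarProjection P)
    (U : Matrix.unitaryGroup (Idx d) ℂ) (φ : (i : Fin k) → EuclideanSpace ℂ (Fin (d i))) :
    (Matrix.trace (tensor (fun i => ketbra (φ i)) * ((U : Op d) * P * (U : Op d)ᴴ))).re =
      ‖mulVecTensor (P * (U⁻¹ : Matrix.unitaryGroup (Idx d) ℂ).1) (fun i => φ i)‖ ^ 2 := by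
  rw [trace_tensor_ketbra_mul, star_dotProduct_conj_mulVec,
    star_dotProduct_projection_mulVec hP, Complex.ofReal_re, mulVecTensor_apply,
    Matrix.mulVec_mulVec]

theorem continuous_mulVecTensor :
    Continuous fun p : Op d × ((i : Fin k) → Fin (d i) → ℂ) => mulVecTensor p.1 p.2 := by
  simp_rw [mulVecTensor_apply]
  fun_prop

theorem continuous_mulVecTensor_right (A : Op d) : Continuous (mulVecTensor A) := by
  refine (continuous_congr (mulVecTensor_apply A)).2 ?_
  fun_prop

/-- The tensor product of unit vectors is a unit vector of `ℂ^D`, and after diagonalising, `P` keeps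
`P.rank` coordinates. -/
theorem lintegral_haar_norm_mulVecTensor_pow (hd : ∀ i, 0 < d i) {P : Op d}
    (hP : IsStarProjection P) (n : ℕ) {φ : (i : Fin k) → Fin (d i) → ℂ}
    (hφ : ∀ i, ∑ j, ‖φ i j‖ ^ 2 = 1) :
    (∫⁻ U, ENNReal.ofReal ((‖mulVecTensor
        (P * (U⁻¹ : Matrix.unitaryGroup (Idx d) ℂ).1) φ‖ ^ 2) ^ n) ∂haarUnitary (Idx d)) *
      (((∏ i, d i) + n - 1).choose n : ℕ) = ((P.rank + n - 1).choose n : ℕ) := by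
  have : Nonempty (Idx d) := ⟨fun i => ⟨0, hd i⟩⟩
  obtain ⟨V, S, hS, h⟩ := exists_unitary_star_dotProduct_mulVec hP
  have hm := lintegral_haar_partial_norm_sq_pow V S n (fun y : Idx d => ∏ i, φ i (y i))
  rw [sum_norm_sq_prod] at hm
  simp only [hφ, Finset.prod_const_one, one_pow, ENNReal.ofReal_one, one_mul, hS,
    Fintype.card_pi, Fintype.card_fin] at hm
  rw [← hm]
  congr 1
  refine lintegral_congr fun U => ?_
  congr 2
  have h2 := h ((U⁻¹ : Matrix.unitaryGroup (Idx d) ℂ).1 *ᵥ fun y : Idx d => ∏ i, φ i (y i))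
  rw [star_dotProduct_projection_mulVec hP] at h2
  rw [mulVecTensor_apply, ← Matrix.mulVec_mulVec]
  exact_mod_cast h2

/-- Supplies measurability of the event. The set is the projection of a closed set along a compact
product of spheres, because the maximum is attained. -/
theorem isClosed_le_nu (hd : ∀ i, 0 < d i) (γ : ℝ) : IsClosed {M : Op d | γ ≤ nu d M} := by
  let f : ((i : Fin k) → Metric.sphere (0 : EuclideanSpace ℂ (Fin (d i))) 1) × Op d → ℝ :=
    fun p => (Matrix.trace (tensor (fun i => ketbra (p.1 i : EuclideanSpace ℂ (Fin (d i)))) *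
      p.2)).re
  have hf : Continuous f := by
    simp only [f, tensor, ketbra, Matrix.trace, Matrix.diag, Matrix.mul_apply, Matrix.of_apply]
    fun_prop
  have h := isClosedMap_snd_of_compactSpace _ (isClosed_le (continuous_const (y := γ)) hf)
  convert h using 1
  ext M
  simp only [Set.mem_image, Set.mem_ofPred_eq, Prod.exists, exists_eq_right]
  constructor
  · intro hM
    obtain ⟨⟨φ, hφ, heq⟩, -⟩ := isGreatest_nu d hd M
    exact ⟨fun i => ⟨φ i, by simp [hφ i]⟩, hM.trans heq.le⟩
  · rintro ⟨φ, hφ⟩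
    exact hφ.trans ((isGreatest_nu d hd M).2 ⟨fun i => φ i, fun i => by simp, rfl⟩)

/-- The bound `ν(Π)ⁿ ≤ ∏ᵢ C(dᵢ+n-1,n) · E[tr((ψ₁ ⊗ ⋯ ⊗ ψ_k) Π)ⁿ]` over Haar-random unit vectors
`ψᵢ`. -/
theorem nu_pow_le_lintegral_haar (hd : ∀ i, 0 < d i) {P : Op d} (hP : IsStarProjection P)
    (U : Matrix.unitaryGroup (Idx d) ℂ) (n : ℕ) (i₀ : (i : Fin k) → Fin (d i)) :
    ENNReal.ofReal (nu d ((U : Op d) * P * (U : Op d)ᴴ) ^ n) ≤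
      (∏ i, ((d i + n - 1).choose n : ENNReal)) *
        ∫⁻ V, ENNReal.ofReal ((‖mulVecTensor (P * (U⁻¹ : Matrix.unitaryGroup (Idx d) ℂ).1)
          (rotate (fun i => Pi.single (i₀ i) 1) V)‖ ^ 2) ^ n)
            ∂Measure.pi fun i => haarUnitary (Fin (d i)) := by
  obtain ⟨⟨φ, hφ, heq⟩, -⟩ := isGreatest_nu d hd ((U : Op d) * P * (U : Op d)ᴴ)
  -- The maximiser is itself a rotation of the reference basis vectors, so the bound for `rotate`
  -- applies to it.
  have hV : ∀ i, ∃ V : Matrix.unitaryGroup (Fin (d i)) ℂ,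
      V⁻¹.1 *ᵥ Pi.single (i₀ i) 1 = ⇑(φ i) := by
    intro i
    refine exists_unitary_inv_mulVec_single_eq (i₀ i) ?_
    rw [← EuclideanSpace.norm_sq_eq, hφ i, one_pow]
  choose V hV using hV
  have hrot : rotate (fun i => Pi.single (i₀ i) 1) V = fun i => ⇑(φ i) := funext hV
  rw [heq, re_trace_tensor_ketbra_mul_conj hP, ← hrot]
  refine (norm_sq_pow_le_lmarginal_haar hd _ ?_ n (fun i => ?_) Finset.univ V).trans_eq ?_
  · exact continuous_mulVecTensor_right _
  · rw [Finset.sum_eq_single (i₀ i)] <;> simp +contextual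
  · rw [lmarginal_univ]

end Multilinear

/-- The moment bound for the maximal overlap of a Haar-random projector with a product state. -/
theorem haarConj_le_nu_mul_le {k : ℕ} {d : Fin k → ℕ} (hd : ∀ i, 0 < d i) {P : Op d}
    (hP : IsStarProjection P) {γ : ℝ} (hγ : 0 < γ) (n : ℕ) :
    ENNReal.ofReal (γ ^ n) * haarConj P {M | γ ≤ nu d M} *
        (((∏ i, d i) + n - 1).choose n : ℕ) ≤
      (∏ i, ((d i + n - 1).choose n : ENNReal)) * ((P.rank + n - 1).choose n : ℕ) := by
  let i₀ : (i : Fin k) → Fin (d i) := fun i => ⟨0, hd i⟩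
  let ν : Measure ((i : Fin k) → Matrix.unitaryGroup (Fin (d i)) ℂ) :=
    Measure.pi fun i => haarUnitary (Fin (d i))
  let F : Matrix.unitaryGroup (Idx d) ℂ → ((i : Fin k) → Matrix.unitaryGroup (Fin (d i)) ℂ) →
      ENNReal := fun U V => ENNReal.ofReal ((‖mulVecTensor
    (P * (U⁻¹ : Matrix.unitaryGroup (Idx d) ℂ).1)
      (rotate (fun i => Pi.single (i₀ i) 1) V)‖ ^ 2) ^ n)
  have hF : Measurable (Function.uncurry F) := by
    refine (ENNReal.continuous_ofReal.comp (((continuous_mulVecTensor.comp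
      (Continuous.prodMk ?_ ?_)).norm.pow 2).pow n)).measurable
    · fun_prop
    · exact (continuous_rotate _).comp continuous_snd
  set C : ENNReal := ∏ i, ((d i + n - 1).choose n : ENNReal)
  have hmarkov : ENNReal.ofReal (γ ^ n) * haarConj P {M | γ ≤ nu d M} ≤
      C * ∫⁻ U, ∫⁻ V, F U V ∂ν ∂haarUnitary (Idx d) := by
    have hm : Measurable fun U => ∫⁻ V, F U V ∂ν := hF.lintegral_prod_right'
    rw [← lintegral_const_mul _ hm, haarConj,
      Measure.map_apply (continuous_conj P).measurable (isClosed_le_nu hd γ).measurableSet]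
    refine le_trans ?_ (mul_meas_ge_le_lintegral (hm.const_mul C)
      (ENNReal.ofReal (γ ^ n)))
    gcongr
    intro U hU
    refine le_trans (ENNReal.ofReal_le_ofReal ?_) (nu_pow_le_lintegral_haar hd hP U n i₀)
    exact pow_le_pow_left₀ hγ.le hU n
  -- With the product vector held fixed, the average over `U` is the exact moment, independent of
  -- `V`.
  rw [lintegral_lintegral_swap hF.aemeasurable] at hmarkov
  calc _ ≤ C * (∫⁻ V, ∫⁻ U, F U V ∂haarUnitary (Idx d) ∂ν) *
        (((∏ i, d i) + n - 1).choose n : ℕ) := by gcongr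
    _ = C * ∫⁻ _, ((P.rank + n - 1).choose n : ℕ) ∂ν := by
      rw [mul_assoc, ← lintegral_mul_const' _ _ (ENNReal.natCast_ne_top _)]
      congr 1
      refine lintegral_congr fun V => lintegral_haar_norm_mulVecTensor_pow hd hP n fun i => ?_
      rw [rotate, sum_norm_sq_unitary_mulVec, Finset.sum_eq_single (i₀ i)] <;> simp +contextual
    _ = _ := by simp

end RandomProjector

/-- For a Haar-random orthogonal projector of rank `r` on `⊗ᵢ ℂ^{dᵢ}`, with `D = ∏ᵢ dᵢ`,
`Pr[ν(Π) ≥ γ] ≤ inf_n C(r+n-1,n) ∏ᵢ C(dᵢ+n-1,n) / (γ^n C(D+n-1,n))`. -/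
theorem mainTheorem3 {k : ℕ} (d : Fin k → ℕ) (hd : ∀ i, 0 < d i) (r : ℕ)
    (P : RandomProjector.Op d) (hP : IsStarProjection P) (hr : P.rank = r)
    (γ : ℝ) (hγ : 0 < γ) :
    (RandomProjector.haarConj P).real {M | γ ≤ RandomProjector.nu d M} ≤
      ⨅ n : ℕ, (((r + n - 1).choose n : ℝ) * ∏ i, ((d i + n - 1).choose n : ℝ)) /
        (γ ^ n * ((∏ i, d i) + n - 1).choose n) := by
  refine le_ciInf fun n => ?_
  have hD : 0 < ((∏ i, d i) + n - 1).choose n := by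
    have : 0 < ∏ i, d i := Finset.prod_pos fun i _ => hd i
    -- `D ≥ 1` gives `n ≤ D + n - 1`, also for `n = 0`.
    exact Nat.choose_pos (by lia)
  rw [le_div_iff₀ (by positivity)]
  have h := RandomProjector.haarConj_le_nu_mul_le hd hP hγ n
  have h2 := ENNReal.toReal_mono (by
    rw [← Nat.cast_prod]
    exact ENNReal.mul_ne_top (ENNReal.natCast_ne_top _) (ENNReal.natCast_ne_top _)) h
  simp only [ENNReal.toReal_mul, ENNReal.toReal_prod, ENNReal.toReal_natCast, hr,
    ENNReal.toReal_ofReal (pow_nonneg hγ.le n)] at h2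
  rw [Measure.real]
  linarith
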